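/- Let $F$ be a field of characteristic $p>0$ and let $G$ be a finite group with a series of normal subgroups of $G$ $$1=G_0\le G_1\le\cdots\le G_n\le G_{n+1}=G .$$ Let $k$ be the number of indices $i\in\{1,\dots,n+1\}$ for which $G_i/G_{i-1}$ is a nontrivial $p$-group. For a simple $F[G]$-module $E$, the Cartan invariant of $G$ corresponding to $E$ is the multiplicity of $E$ as a composition factor of the projective cover of $E$ over $F[G]$. Then: 1. For every simple $F[G/G_n]$-module $E_j$, the Cartan invariant $c_{jj}$ of $G$ corresponding to $E_j$, regarded as an $F[G]$-module by inflation, satisfies $c_{jj}\ge k+1$. 2. If $G/G_n$ is a $p$-group, then the Cartan invariant $c_{11}$ of $G$ corresponding to the trivial module $F$ satisfies $c_{11}\ge |G/G_n|+k-1$. -/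

import Mathlib

open Classical in
/-- The number of factors of the composition series `s` that are isomorphic to `E`. -/
noncomputable def factorCount {R M : Type*} [Ring R] [AddCommGroup M] [Module R M]
    (E : Type*) [AddCommGroup E] [Module R E] (s : CompositionSeries (Submodule R M)) : ℕ :=
  Finset.card {i : Fin s.length |
    Nonempty ((s i.succ ⧸ (s i.castSucc).submoduleOf (s i.succ)) ≃ₗ[R] E)}

open Classical in
/-- The multiplicity of `E` as a composition factor of `M`: the number of factors isomorphic to `E`
in a composition series of `M` from `⊥` to `⊤` (independent of the series by Jordan–Hölder).
It is `0` if `M` has no composition series. -/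
noncomputable def compositionMultiplicity (R E M : Type*) [Ring R]
    [AddCommGroup E] [Module R E] [AddCommGroup M] [Module R M] : ℕ :=
  if h : ∃ s : CompositionSeries (Submodule R M), s.head = ⊥ ∧ s.last = ⊤ then
    factorCount E h.choose
  else 0

/-- `π : P → E` is a projective cover: `P` is projective, and `π` is surjective with superfluous
kernel. -/
structure IsProjectiveCover {R P E : Type*} [Ring R] [AddCommGroup P] [Module R P]
    [AddCommGroup E] [Module R E] (π : P →ₗ[R] E) : Prop where
  projective : Module.Projective R P
  surjective : Function.Surjective π
  superfluous : ∀ U : Submodule R P, U ⊔ LinearMap.ker π = ⊤ → U = ⊤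

open Classical in
/-- The diagonal Cartan invariant of the ring `R` at a simple left `R`-module `E`: the multiplicity
of `E` as a composition factor of the projective cover of `E`. For Artinian `R` the projective cover
of a simple module is realised by a left ideal of `R` (a principal indecomposable module), and it is
unique up to isomorphism. The value is `0` if no left ideal is a projective cover of `E`. -/
noncomputable def cartanNumber (R E : Type*) [Ring R] [AddCommGroup E] [Module R E] : ℕ :=
  if h : ∃ P : Submodule R R, ∃ π : P →ₗ[R] E, IsProjectiveCover π then
    compositionMultiplicity R E h.choose
  else 0

/-- The Cartan invariant of the group `G` over `F` corresponding to a (simple) `F[G]`-module, the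
latter given as a representation `ρ`. -/
noncomputable def groupCartanNumber {F G V : Type*} [Field F] [Group G] [AddCommGroup V]
    [Module F V] (ρ : Representation F G V) : ℕ :=
  cartanNumber (MonoidAlgebra F G) ρ.asModule

/-- The representation of `G` inflated from a representation of `G ⧸ N`. -/
noncomputable def inflate {F G V : Type*} [Field F] [Group G] [AddCommGroup V] [Module F V]
    (N : Subgroup G) [N.Normal] (ρ : Representation F (G ⧸ N) V) : Representation F G V :=
  ρ.comp (QuotientGroup.mk' N)

open Classical in
/-- For a series `H 0 ≤ H 1 ≤ ⋯ ≤ H (n + 1)` of normal subgroups, the number of indices `i` for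
which the factor `H (i + 1) / H i` is a nontrivial `p`-group. -/
noncomputable def pFactorCount {G : Type*} [Group G] (p : ℕ) {n : ℕ}
    (H : Fin (n + 2) → Subgroup G) [∀ i, (H i).Normal] : ℕ :=
  Finset.card {i : Fin (n + 1) |
    IsPGroup p (H i.succ ⧸ (H i.castSucc).subgroupOf (H i.succ)) ∧
      Nontrivial (H i.succ ⧸ (H i.castSucc).subgroupOf (H i.succ))}

/-! Let `P` be the projective cover of `E` and `s_N` the sum in `F[G]` of the elements of a normal
subgroup `N`. Since `P` is projective, `dim Hom(P, M)` is additive in `M`. It equals the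
multiplicity of `E` in `M` times `d = dim Hom(P, E) > 0`, so multiplicities can be estimated through
`homDim`.

The submodules `s_{G_i} P` descend as `i` grows. If `p` divides `|G_i/G_{i-1}|` for some `i ≤ n`,
the inclusion `s_{G_i} P ≤ s_{G_{i-1}} P` is strict. The quotient is a nonzero image of `P`, hence
maps onto `E`, and costs one factor `E` (`IsProjectiveCover.homDim_range_add_le`). The bottom term
`s_{G_n} P` is nonzero and contains another factor `E`. If `G/G_n` is a `p`-group, then `E` is the
trivial line and `s_{G_n} P` contains a copy of `s_{G_n} F[G]`, so it contributes at least `|G/G_n|`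
factors (`IsProjectiveCover.card_mul_le_homDim_range`). -/

/-! ### Dimension of `Hom(P, -)` and its additivity. -/

section HomDim

variable {F A : Type*} [Field F] [Ring A] [Algebra F A]
variable (P : Type*) [AddCommGroup P] [Module A P]

/-- Postcomposition with an `A`-linear map, as an `F`-linear map between spaces of `A`-linear
maps. -/
def postcomp (F : Type*) [Field F] [Algebra F A] (P : Type*) [AddCommGroup P] [Module A P]
    {M M' : Type*} [AddCommGroup M] [Module F M] [Module A M] [IsScalarTower F A M]
    [AddCommGroup M'] [Module F M'] [Module A M'] [IsScalarTower F A M'] (f : M →ₗ[A] M') :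
    (P →ₗ[A] M) →ₗ[F] (P →ₗ[A] M') where
  toFun g := f ∘ₗ g
  map_add' g h := LinearMap.comp_add g h f
  map_smul' c g := by
    ext x
    exact f.map_smul_of_tower c (g x)

@[simp]
theorem postcomp_apply {M M' : Type*} [AddCommGroup M] [Module F M] [Module A M]
    [IsScalarTower F A M] [AddCommGroup M'] [Module F M'] [Module A M'] [IsScalarTower F A M']
    (f : M →ₗ[A] M') (g : P →ₗ[A] M) : postcomp F P f g = f ∘ₗ g := rfl

/-- The `F`-dimension of `Hom_A(P, M)`. -/
noncomputable def homDim (F A P M : Type*) [Field F] [Ring A] [Algebra F A]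
    [AddCommGroup P] [Module A P] [AddCommGroup M] [Module F M] [Module A M]
    [IsScalarTower F A M] : ℕ :=
  Module.finrank F (P →ₗ[A] M)

variable {M M' : Type*} [AddCommGroup M] [Module F M] [Module A M] [IsScalarTower F A M]
  [AddCommGroup M'] [Module F M'] [Module A M'] [IsScalarTower F A M']

instance finiteDimensional_linearMap_of_tower [Module F P] [IsScalarTower F A P]
    [FiniteDimensional F P] [FiniteDimensional F M] :
    FiniteDimensional F (P →ₗ[A] M) :=
  FiniteDimensional.of_injective (LinearMap.restrictScalarsₗ F A P M F)
    (LinearMap.restrictScalars_injective F)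

theorem homDim_le_of_injective [Module F P] [IsScalarTower F A P]
    [FiniteDimensional F P] [FiniteDimensional F M']
    (f : M →ₗ[A] M') (hf : Function.Injective f) : homDim F A P M ≤ homDim F A P M' :=
  LinearMap.finrank_le_finrank_of_injective (f := postcomp F P f) fun _ _ h =>
    LinearMap.ext fun x => hf (LinearMap.congr_fun h x)

theorem postcomp_surjective [Module.Projective A P] (f : M →ₗ[A] M')
    (hf : Function.Surjective f) : Function.Surjective (postcomp F P f) :=
  fun g => Module.projective_lifting_property f g hf

theorem homDim_le_of_surjective [Module F P] [IsScalarTower F A P]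
    [FiniteDimensional F P] [FiniteDimensional F M]
    [Module.Projective A P] (f : M →ₗ[A] M') (hf : Function.Surjective f) :
    homDim F A P M' ≤ homDim F A P M :=
  LinearMap.finrank_le_finrank_of_surjective (f := postcomp F P f) (postcomp_surjective P f hf)

theorem homDim_congr (e : M ≃ₗ[A] M') : homDim F A P M = homDim F A P M' := by
  refine LinearEquiv.finrank_eq (LinearEquiv.ofBijective (postcomp F P (e : M →ₗ[A] M'))
    ⟨fun _ _ h => LinearMap.ext fun x => e.injective (LinearMap.congr_fun h x), fun g =>
      ⟨(e.symm : M' →ₗ[A] M) ∘ₗ g, ?_⟩⟩)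
  ext x
  simp

theorem homDim_eq_add_quotient [Module F P] [IsScalarTower F A P]
    [FiniteDimensional F P] [FiniteDimensional F M]
    [Module.Projective A P] (K : Submodule A M) :
    homDim F A P M = homDim F A P K + homDim F A P (M ⧸ K) := by
  have h := LinearMap.finrank_range_add_finrank_ker (postcomp F P K.mkQ)
  rw [LinearMap.range_eq_top.mpr (postcomp_surjective P K.mkQ K.mkQ_surjective),
    finrank_top] at h
  have hinj : Function.Injective (postcomp F P K.subtype) := fun _ _ h =>
    LinearMap.ext fun x => K.injective_subtype (LinearMap.congr_fun h x)
  have hker : LinearMap.ker (postcomp F P K.mkQ) = LinearMap.range (postcomp F P K.subtype) := by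
    ext g
    constructor
    · intro hg
      have hg' : ∀ x, g x ∈ K := fun x => by
        have := LinearMap.congr_fun (LinearMap.mem_ker.mp hg) x
        simpa using this
      exact ⟨g.codRestrict K hg', by ext x; rfl⟩
    · rintro ⟨g, rfl⟩
      refine LinearMap.mem_ker.mpr ?_
      ext x
      simp
  rw [hker, LinearMap.finrank_range_of_inj hinj] at h
  simp only [homDim]
  omega

theorem homDim_eq_add_submoduleOf [Module F P] [IsScalarTower F A P]
    [FiniteDimensional F P] [FiniteDimensional F M]
    [Module.Projective A P] {U V : Submodule A M} (h : U ≤ V) :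
    homDim F A P V = homDim F A P U + homDim F A P (V ⧸ U.submoduleOf V) := by
  have : FiniteDimensional F V :=
    FiniteDimensional.of_injective (V.subtype.restrictScalars F) V.injective_subtype
  rw [homDim_eq_add_quotient P (U.submoduleOf V), homDim_congr P (Submodule.submoduleOfEquivOfLe h)]

end HomDim

/-! ### Quotients of the projective cover of a simple module. -/

section ProjectiveCover

variable {A P E : Type*} [Ring A] [AddCommGroup P] [Module A P] [AddCommGroup E] [Module A E]
  [IsSimpleModule A E]

/-- The kernel of `π` is maximal and superfluous, so it contains every proper submodule. In
particular it contains `ker f`, and `π` factors through `f`. -/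
theorem IsProjectiveCover.exists_surjective_of_surjective {π : P →ₗ[A] E}
    (hπ : IsProjectiveCover π) {M : Type*} [AddCommGroup M] [Module A M] [Nontrivial M]
    (f : P →ₗ[A] M) (hf : Function.Surjective f) : ∃ g : M →ₗ[A] E, Function.Surjective g := by
  have hcoatom : IsCoatom (LinearMap.ker π) :=
    (LinearMap.isCoatom_ker_of_surjective hπ.surjective)
  have hker : LinearMap.ker f ≤ LinearMap.ker π := by
    by_contra hle
    have hsup : LinearMap.ker f ⊔ LinearMap.ker π = ⊤ :=
      hcoatom.2 _ (right_lt_sup.mpr hle)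
    have h0 : f = 0 := LinearMap.ker_eq_top.mp (hπ.superfluous _ hsup)
    obtain ⟨m, hm⟩ := exists_ne (0 : M)
    obtain ⟨x, rfl⟩ := hf m
    simp [h0] at hm
  refine ⟨((LinearMap.ker f).liftQ π hker) ∘ₗ (f.quotKerEquivOfSurjective hf).symm, ?_⟩
  intro e
  obtain ⟨x, rfl⟩ := hπ.surjective e
  refine ⟨f x, ?_⟩
  have : (f.quotKerEquivOfSurjective hf).symm (f x) = (LinearMap.ker f).mkQ x := by
    rw [LinearEquiv.symm_apply_eq]; rfl
  simp [this]

theorem IsProjectiveCover.nonempty_equiv_of_ne_zero {π : P →ₗ[A] E} (hπ : IsProjectiveCover π)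
    {S : Type*} [AddCommGroup S] [Module A S] [IsSimpleModule A S] (f : P →ₗ[A] S) (hf : f ≠ 0) :
    Nonempty (S ≃ₗ[A] E) := by
  have := IsSimpleModule.nontrivial A S
  obtain ⟨g, hg⟩ :=
    hπ.exists_surjective_of_surjective f ((f.surjective_or_eq_zero).resolve_right hf)
  have hg0 : g ≠ 0 := by
    rintro rfl
    have := IsSimpleModule.nontrivial A E
    obtain ⟨e, he⟩ := exists_ne (0 : E)
    obtain ⟨x, rfl⟩ := hg e
    simp at he
  exact ⟨LinearEquiv.ofBijective g ((g.bijective_or_eq_zero).resolve_right hg0)⟩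

end ProjectiveCover

/-! ### Telescoping along a finite chain. -/

theorem Fin.apply_last_eq_add_sum {n : ℕ} (f : Fin (n + 1) → ℕ) (g : Fin n → ℕ)
    (h : ∀ i, f i.succ = f i.castSucc + g i) : f (Fin.last n) = f 0 + ∑ i, g i := by
  induction n with
  | zero => simp
  | succ n ih =>
    rw [Fin.sum_univ_castSucc, ← add_assoc, ← Fin.succ_last, h,
      ← Fin.castSucc_zero,
      ← ih (fun i => f i.castSucc) (fun i => g i.castSucc) fun i => by
        simpa [Fin.castSucc_succ] using h i.castSucc]

theorem Fin.add_sum_le_apply_zero {n : ℕ} (f : Fin (n + 1) → ℕ) (g : Fin n → ℕ)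
    (h : ∀ i, f i.succ + g i ≤ f i.castSucc) : f (Fin.last n) + ∑ i, g i ≤ f 0 := by
  induction n with
  | zero => simp
  | succ n ih =>
    have h1 := ih (fun i => f i.castSucc) (fun i => g i.castSucc) fun i => by
        simpa [Fin.castSucc_succ] using h i.castSucc
    have h2 : f (Fin.last (n + 1)) + g (Fin.last n) ≤ f (Fin.last n).castSucc := h (Fin.last n)
    rw [Fin.sum_univ_castSucc]
    simp only [Fin.castSucc_zero] at h1
    omega

/-! ### Multiplicities as dimensions of Hom spaces. -/

section Multiplicity

variable {F A : Type*} [Field F] [Ring A] [Algebra F A]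
variable {P : Type*} [AddCommGroup P] [Module F P] [Module A P] [IsScalarTower F A P]
variable {E : Type*} [AddCommGroup E] [Module F E] [Module A E] [IsScalarTower F A E]
  [IsSimpleModule A E]
variable {M : Type*} [AddCommGroup M] [Module F M] [Module A M] [IsScalarTower F A M]

/-- Along the series each factor adds `dim Hom(P, E)` if it is isomorphic to `E` and `0` otherwise,
because `P` has no nonzero map to any other simple module. The common factor stays in the formula
because `F` need not be a splitting field. -/
theorem IsProjectiveCover.homDim_eq_factorCount_mul [FiniteDimensional F P]
    [FiniteDimensional F M] {π : P →ₗ[A] E} (hπ : IsProjectiveCover π)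
    (s : CompositionSeries (Submodule A M)) (h0 : s.head = ⊥) (h1 : s.last = ⊤) :
    homDim F A P M = factorCount E s * homDim F A P E := by
  classical
  have := hπ.projective
  have hstep : ∀ i : Fin s.length, homDim F A P (s i.succ) = homDim F A P (s i.castSucc) +
      if Nonempty ((s i.succ ⧸ (s i.castSucc).submoduleOf (s i.succ)) ≃ₗ[A] E)
      then homDim F A P E else 0 := by
    intro i
    have hcov : s i.castSucc ⋖ s i.succ := s.step i
    rw [homDim_eq_add_submoduleOf P hcov.le]
    congr 1
    split_ifs with h
    · exact homDim_congr P h.some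
    · have : IsSimpleModule A (s i.succ ⧸ (s i.castSucc).submoduleOf (s i.succ)) :=
        (covBy_iff_quot_is_simple hcov.le).mp hcov
      have hsub : Subsingleton (P →ₗ[A] (s i.succ ⧸ (s i.castSucc).submoduleOf (s i.succ))) :=
        ⟨fun f g => by
          by_contra hne
          exact h (hπ.nonempty_equiv_of_ne_zero (f - g) (sub_ne_zero.mpr hne))⟩
      exact Module.finrank_zero_of_subsingleton
  have hsum := Fin.apply_last_eq_add_sum (fun i => homDim F A P (s i)) _ hstep
  have hlast : homDim F A P (s (Fin.last _)) = homDim F A P M := by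
    rw [show s (Fin.last _) = ⊤ from h1]
    exact homDim_congr P Submodule.topEquiv
  have hhead : homDim F A P (s 0) = 0 := by
    rw [show s 0 = ⊥ from h0]
    exact Module.finrank_zero_of_subsingleton
  rw [hlast, hhead, zero_add] at hsum
  rw [hsum, ← Finset.sum_filter, Finset.sum_const, smul_eq_mul, factorCount]

theorem IsProjectiveCover.homDim_pos [FiniteDimensional F P]
    {π : P →ₗ[A] E} (hπ : IsProjectiveCover π) : 0 < homDim F A P E := by
  have : FiniteDimensional F E :=
    Module.Finite.of_surjective (π.restrictScalars F) hπ.surjective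
  have := IsSimpleModule.nontrivial A E
  have : Nontrivial (P →ₗ[A] E) := by
    refine ⟨π, 0, ?_⟩
    rintro rfl
    obtain ⟨e, he⟩ := exists_ne (0 : E)
    obtain ⟨x, rfl⟩ := hπ.surjective e
    simp at he
  exact Module.finrank_pos

theorem IsProjectiveCover.homDim_eq_compositionMultiplicity_mul [FiniteDimensional F P]
    [FiniteDimensional F M] {π : P →ₗ[A] E} (hπ : IsProjectiveCover π) :
    homDim F A P M = compositionMultiplicity A E M * homDim F A P E := by
  have : IsNoetherian A M := isNoetherian_of_tower F inferInstance
  have : IsArtinian A M := isArtinian_of_tower F inferInstance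
  have h : ∃ s : CompositionSeries (Submodule A M), s.head = ⊥ ∧ s.last = ⊤ :=
    exists_compositionSeries_of_isNoetherian_isArtinian A M
  rw [compositionMultiplicity, dif_pos h]
  exact hπ.homDim_eq_factorCount_mul _ h.choose_spec.1 h.choose_spec.2

end Multiplicity

/-! ### Projective covers of simple modules over Artinian rings. -/

section Existence

variable {A : Type*} [Ring A] [IsArtinianRing A]

/-- A projective left ideal, minimal among those with a nonzero map to `E`, works: if `U` and `ker
π` span it, lifting `π` through `U` gives an endomorphism `φ` with image in `U` and `π ∘ φ = π`.
Fitting's lemma and minimality then force `U` to be everything. -/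
theorem exists_isProjectiveCover (E : Type*) [AddCommGroup E] [Module A E] [IsSimpleModule A E] :
    ∃ P : Submodule A A, ∃ π : P →ₗ[A] E, IsProjectiveCover π := by
  have := IsSimpleModule.nontrivial A E
  let S : Set (Submodule A A) := {P | Module.Projective A P ∧ ∃ f : P →ₗ[A] E, f ≠ 0}
  have hS : S.Nonempty := by
    refine ⟨⊤, Module.Projective.of_equiv (Submodule.topEquiv (R := A) (M := A)).symm, ?_⟩
    obtain ⟨e, he⟩ := exists_ne (0 : E)
    refine ⟨LinearMap.toSpanSingleton A E e ∘ₗ Submodule.subtype ⊤, fun h => he ?_⟩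
    simpa using LinearMap.congr_fun h ⟨1, trivial⟩
  obtain ⟨P, ⟨hproj, π, hπ⟩, hmin⟩ := WellFounded.has_min wellFounded_lt S hS
  have hsurj := (π.surjective_or_eq_zero).resolve_right hπ
  refine ⟨P, π, hproj, hsurj, fun U hU => ?_⟩
  have hUsurj : Function.Surjective (π ∘ₗ U.subtype) := by
    intro e
    obtain ⟨x, rfl⟩ := hsurj e
    obtain ⟨u, hu, k, hk, rfl⟩ := Submodule.mem_sup.mp (hU ▸ Submodule.mem_top : x ∈ U ⊔ _)
    exact ⟨⟨u, hu⟩, by simpa using (LinearMap.mem_ker.mp hk)⟩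
  obtain ⟨f, hf⟩ := Module.projective_lifting_property (π ∘ₗ U.subtype) π hUsurj
  let φ : Module.End A P := U.subtype ∘ₗ f
  have hφ : ∀ x, π (φ x) = π x := fun x => LinearMap.congr_fun hf x
  have hφn : ∀ n x, π ((φ ^ n) x) = π x := by
    intro n
    induction n with
    | zero => simp
    | succ n ih => intro x; rw [pow_succ', Module.End.mul_apply, hφ, ih]
  obtain ⟨n, hn⟩ := Filter.eventually_atTop.mp φ.eventually_isCompl_ker_pow_range_pow
  -- The exponent must be positive, so that the range of the power lies in the range of `φ`, hence
  -- in `U`.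
  have hc := hn (n + 1) (Nat.le_succ n)
  set R := LinearMap.range (φ ^ (n + 1)) with hR
  set K := LinearMap.ker (φ ^ (n + 1))
  have hmem : R.map P.subtype ∈ S := by
    refine ⟨?_, ?_⟩
    · have : Module.Projective A R :=
        Module.Projective.of_split R.subtype (R.projectionOnto K hc.symm) (by ext x; simp)
      exact Module.Projective.of_equiv
        (Submodule.equivMapOfInjective P.subtype P.injective_subtype R)
    · refine ⟨π ∘ₗ Submodule.inclusion (Submodule.map_subtype_le P R) , ?_⟩
      obtain ⟨x, hx⟩ := DFunLike.ne_iff.mp hπ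
      intro h0
      apply hx
      have := LinearMap.congr_fun h0
        ⟨(φ ^ (n + 1)) x, Submodule.mem_map_of_mem (f := P.subtype) (LinearMap.mem_range_self _ x)⟩
      rw [← hφn (n + 1) x]
      exact this
  have hRtop : R = ⊤ := by
    have h := hmin _ hmem
    have h' : R.map P.subtype = P :=
      (Submodule.map_subtype_le P R).eq_of_not_lt h
    rw [eq_top_iff]
    intro x _
    have hx : (x : A) ∈ R.map P.subtype := h'.ge x.2
    obtain ⟨y, hy, hyx⟩ := hx
    exact (Subtype.ext hyx : y = x) ▸ hy
  rw [eq_top_iff, ← hRtop]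
  rintro _ ⟨x, rfl⟩
  rw [pow_succ']
  exact (f _).2

end Existence

/-! ### Sums over normal subgroups in the group algebra. -/

section SubgroupSum

open MonoidAlgebra

variable {F G : Type*} [Field F] [Group G] [Fintype G]

open Classical in
/-- The sum of the elements of the subgroup `N` in the group algebra `F[G]`. -/
noncomputable def subgroupSum (F : Type*) {G : Type*} [Field F] [Group G] [Fintype G]
    (N : Subgroup G) : MonoidAlgebra F G :=
  ∑ g : G with g ∈ N, single g 1

/-- The subgroup `N` of `G` acts trivially on the `F[G]`-module `M`. -/
def ActsTrivially (F : Type*) {G : Type*} [Field F] [Group G] (N : Subgroup G) (M : Type*)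
    [AddCommGroup M] [Module (MonoidAlgebra F G) M] : Prop :=
  ∀ h ∈ N, ∀ v : M, single h (1 : F) • v = v

theorem single_mul_subgroupSum {N : Subgroup G} {h : G} (hh : h ∈ N) :
    single h 1 * subgroupSum F N = subgroupSum F N := by
  classical
  simp only [subgroupSum, Finset.mul_sum, single_mul_single, mul_one]
  refine Finset.sum_bij' (fun g _ => h * g) (fun g _ => h⁻¹ * g) ?_ ?_ ?_ ?_ ?_ <;>
    simp [mul_mem_cancel_left, hh]

theorem commute_subgroupSum (N : Subgroup G) [N.Normal] (a : MonoidAlgebra F G) :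
    a * subgroupSum F N = subgroupSum F N * a := by
  classical
  induction a using MonoidAlgebra.induction_linear with
  | zero => simp
  | add x y hx hy => rw [add_mul, mul_add, hx, hy]
  | single g c =>
    simp only [subgroupSum, Finset.mul_sum, Finset.sum_mul, single_mul_single, mul_one, one_mul]
    refine Finset.sum_bij' (fun x _ => g * x * g⁻¹) (fun x _ => g⁻¹ * x * g) ?_ ?_ ?_ ?_ ?_
    · intro x hx
      simpa using ‹N.Normal›.conj_mem x (by simpa using hx) g
    · intro x hx
      simpa using ‹N.Normal›.conj_mem x (by simpa using hx) g⁻¹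
    all_goals simp [mul_assoc]

/-- The coset sums on the right are the coefficients of the image of `a` in `F[G/N]`; so `s_N`
annihilates exactly the kernel of `F[G] → F[G/N]`. -/
theorem coeff_subgroupSum_mul (N : Subgroup G) [N.Normal] [DecidableEq (G ⧸ N)]
    (a : MonoidAlgebra F G) (g : G) :
    (subgroupSum F N * a).coeff g = ∑ x : G with (QuotientGroup.mk x : G ⧸ N) = QuotientGroup.mk g, a.coeff x := by
  classical
  induction a using MonoidAlgebra.induction_linear with
  | zero => simp
  | add x y hx hy => simp [mul_add, hx, hy, Finset.sum_add_distrib]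
  | single y c =>
    have h : ∀ x : G, x * y = g ↔ x = g * y⁻¹ := fun x => by rw [eq_mul_inv_iff_mul_eq]
    have h' : g * y⁻¹ ∈ N ↔ (y : G ⧸ N) = g := by
      rw [eq_comm, ← div_eq_mul_inv, QuotientGroup.eq_iff_div_mem]
    simp [subgroupSum, Finset.sum_mul, single_mul_single, Finsupp.single_apply, h,
      Finset.sum_ite_eq, h']

section Module

variable {M : Type*} [AddCommGroup M] [Module (MonoidAlgebra F G) M]

/-- On a vector fixed by `N`, `a` acts through its coset sums, and these vanish when `s_N * a = 0`.
-/
theorem smul_eq_zero_of_subgroupSum_mul_eq_zero {N : Subgroup G} [N.Normal] {v : M}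
    (hv : ∀ h ∈ N, single h (1 : F) • v = v) {a : MonoidAlgebra F G}
    (ha : subgroupSum F N * a = 0) : a • v = 0 := by
  classical
  have hout : ∀ g : G, single g (1 : F) • v = single (g : G ⧸ N).out (1 : F) • v := by
    intro g
    obtain ⟨n, hn⟩ := QuotientGroup.mk_out_eq_mul N g
    rw [hn, ← mul_one (1 : F), ← single_mul_single, mul_smul, mul_one, hv n n.2]
  have h1 : a = ∑ g, single (1 : G) (a.coeff g) * single g 1 := by
    conv_lhs => rw [← sum_coeff_single a]
    rw [Finsupp.sum_fintype _ _ (by simp)]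
    simp [single_mul_single]
  rw [h1, Finset.sum_smul, ← Finset.sum_fiberwise (g := fun g : G => (g : G ⧸ N))]
  refine Finset.sum_eq_zero fun q _ => ?_
  have h2 : ∀ g ∈ Finset.univ.filter (fun g : G => (g : G ⧸ N) = q),
      (single (1 : G) (a.coeff g) * single g 1) • v =
        (single (1 : G) (a.coeff g)) • (single q.out (1 : F) • v) := by
    intro g hg
    rw [mul_smul, hout, (Finset.mem_filter.mp hg).2]
  have h3 : ∑ g : G with (QuotientGroup.mk g : G ⧸ N) = q, single (1 : G) (a.coeff g) = 0 := by
    have h4 := coeff_subgroupSum_mul N a q.out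
    rw [ha] at h4
    simp only [coeff_zero, Finsupp.coe_zero, Pi.zero_apply, QuotientGroup.out_eq'] at h4
    have h5 := congrArg (singleAddHom (R := F) (1 : G)) h4.symm
    simpa using h5
  rw [Finset.sum_congr rfl h2, ← Finset.sum_smul, h3, zero_smul]

/-- Multiplication by the sum of the elements of a normal subgroup. -/
noncomputable def subgroupSumHom (F : Type*) {G : Type*} [Field F] [Group G] [Fintype G]
    (N : Subgroup G) [N.Normal] (M : Type*) [AddCommGroup M] [Module (MonoidAlgebra F G) M] :
    M →ₗ[MonoidAlgebra F G] M where
  toFun x := subgroupSum F N • x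
  map_add' := smul_add _
  map_smul' a x := by
    rw [RingHom.id_apply, ← mul_smul, ← mul_smul, commute_subgroupSum]

@[simp]
theorem subgroupSumHom_apply (N : Subgroup G) [N.Normal] (x : M) :
    subgroupSumHom F N M x = subgroupSum F N • x := rfl

theorem actsTrivially_range_subgroupSumHom (N : Subgroup G) [N.Normal] :
    ActsTrivially F N (LinearMap.range (subgroupSumHom F N M)) := by
  rintro h hh ⟨_, x, rfl⟩
  ext
  simp [← mul_smul, single_mul_subgroupSum hh]

/-- A projective module embeds in a free one. If `s_N` killed `M`, it would kill all coordinates of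
every `x`. These coordinates then act as zero on `E`, where `N` is trivial, which forces `π x = 0`.
-/
theorem exists_subgroupSum_smul_ne_zero {E : Type*} [AddCommGroup E]
    [Module (MonoidAlgebra F G) E] [Nontrivial E] {N : Subgroup G} [N.Normal]
    (hE : ActsTrivially F N E) [hM : Module.Projective (MonoidAlgebra F G) M]
    (π : M →ₗ[MonoidAlgebra F G] E) (hπ : Function.Surjective π) :
    ∃ x : M, subgroupSum F N • x ≠ 0 := by
  by_contra! h
  obtain ⟨s, hs⟩ := Module.projective_def.mp hM
  obtain ⟨e, he⟩ := exists_ne (0 : E)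
  obtain ⟨x, rfl⟩ := hπ e
  apply he
  rw [← hs x, Finsupp.linearCombination_apply, Finsupp.sum, map_sum]
  refine Finset.sum_eq_zero fun y _ => ?_
  rw [map_smul]
  refine smul_eq_zero_of_subgroupSum_mul_eq_zero (N := N) (fun h hh => hE h hh _) ?_
  have := congrArg (fun t => t y) (map_smul s (subgroupSum F N) x)
  simpa [h x] using this.symm

end Module

/-- The element `t` is the sum of representatives of the left cosets of `N` in `N'`. On `N'`-fixed
vectors it acts as the index, which is zero in `F` when `p` divides it. -/
theorem exists_mul_subgroupSum {N N' : Subgroup G} (hle : N ≤ N') (M : Type*) [AddCommGroup M]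
    [Module (MonoidAlgebra F G) M] :
    ∃ t : MonoidAlgebra F G, subgroupSum F N' = t * subgroupSum F N ∧
      ∀ v : M,
        (∀ h ∈ N', single h (1 : F) • v = v) →
          t • v = Nat.card (N' ⧸ N.subgroupOf N') • v := by
  classical
  refine ⟨∑ q : N' ⧸ N.subgroupOf N', single (q.out : G) 1, ?_, fun v hv => ?_⟩
  · rw [Finset.sum_mul]
    have h1 : subgroupSum F N' = ∑ g : N', single (g : G) (1 : F) :=
      (Finset.sum_subtype _ (by simp) _)
    rw [h1, ← Finset.sum_fiberwise (g := fun g : N' => (g : N' ⧸ N.subgroupOf N'))]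
    refine Finset.sum_congr rfl fun q _ => ?_
    simp only [subgroupSum, Finset.mul_sum, single_mul_single, mul_one]
    refine Finset.sum_bij' (fun g _ => (q.out : G)⁻¹ * g)
      (fun n hn => q.out * ⟨n, hle (by simpa using hn)⟩) ?_ ?_ ?_ ?_ ?_
    · intro g hg
      have : (q.out : N' ⧸ N.subgroupOf N') = g := by
        rw [QuotientGroup.out_eq']; exact (Finset.mem_filter.mp hg).2.symm
      rw [QuotientGroup.eq, Subgroup.mem_subgroupOf] at this
      simpa using this
    · intro n hn
      simp only [Finset.mem_filter, Finset.mem_univ, true_and] at hn ⊢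
      conv_rhs => rw [← QuotientGroup.out_eq' q]
      refine QuotientGroup.mk_mul_of_mem _ ?_
      simpa [Subgroup.mem_subgroupOf] using hn
    · exact fun g _ => Subtype.ext (by simp)
    · simp
    · simp
  · rw [Finset.sum_smul, Finset.sum_congr rfl (fun q _ => hv _ q.out.2), Finset.sum_const,
      Finset.card_univ, Nat.card_eq_fintype_card]

/-- The products of `s_N` with coset representatives are supported on distinct cosets, hence
independent. -/
theorem card_quotient_le_finrank_range_subgroupSumHom (N : Subgroup G) [N.Normal] :
    Nat.card (G ⧸ N) ≤
      Module.finrank F (LinearMap.range (subgroupSumHom F N (MonoidAlgebra F G))) := by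
  classical
  let lift : (G ⧸ N → F) →ₗ[F] MonoidAlgebra F G :=
    Fintype.linearCombination F fun q : G ⧸ N => single q.out (1 : F)
  let Φ : (G ⧸ N → F) →ₗ[F] LinearMap.range (subgroupSumHom F N (MonoidAlgebra F G)) :=
    ((subgroupSumHom F N (MonoidAlgebra F G)).rangeRestrict.restrictScalars F) ∘ₗ lift
  have hΦ : ∀ f q, (Φ f : MonoidAlgebra F G).coeff q.out = f q := by
    intro f q
    change (subgroupSum F N * lift f).coeff q.out = f q
    rw [coeff_subgroupSum_mul]
    simp only [lift, Fintype.linearCombination_apply, coeff_sum, coeff_smul, coeff_single,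
      Finsupp.coe_finsetSum, Finset.sum_apply, Finsupp.smul_apply]
    rw [Finset.sum_comm, Finset.sum_eq_single q]
    · simp [Finsupp.single_apply]
    · intro r _ hr
      refine Finset.sum_eq_zero fun x hx => ?_
      have hx' : (x : G ⧸ N) = q := by simpa using hx
      rw [Finsupp.single_apply, if_neg, smul_zero]
      rintro rfl
      exact hr (by simpa using hx')
    · simp
  have hinj : Function.Injective Φ := by
    intro f f' h
    ext q
    rw [← hΦ f, ← hΦ f', h]
  have := LinearMap.finrank_le_finrank_of_injective hinj
  rwa [Module.finrank_fintype_fun_eq_card, ← Nat.card_eq_fintype_card] at this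

end SubgroupSum

/-! ### Fixed vectors of `p`-groups in characteristic `p`. -/

section FixedVector

open MonoidAlgebra

variable {F G : Type*} [Field F] [Group G] [Finite G]

/-- The field may be infinite, so orbits are counted in the span over the prime field of the
`G`-orbit of a nonzero `v`. It is a finite group of order divisible by `p`, so the fixed point `0`
is not the only one. -/
theorem exists_fixed_ne_zero (p : ℕ) [Fact p.Prime] [CharP F p] {N : Subgroup G} [N.Normal]
    (hN : IsPGroup p (G ⧸ N)) {M : Type*} [AddCommGroup M] [Module (MonoidAlgebra F G) M]
    [Nontrivial M] (hM : ActsTrivially F N M) :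
    ∃ v : M, v ≠ 0 ∧ ∀ g : G, single g (1 : F) • v = v := by
  classical
  have := Fintype.ofFinite G
  obtain ⟨v, hv⟩ := exists_ne (0 : M)
  let c : ZMod p →+* F := ZMod.castHom dvd_rfl F
  have : NeZero p := ⟨(Fact.out : p.Prime).ne_zero⟩
  let f : (G → ZMod p) →+ M :=
    { toFun := fun a => ∑ g, single g (c (a g)) • v
      map_zero' := by simp
      map_add' := fun a b => by simp [single_add, add_smul, Finset.sum_add_distrib] }
  have hmem : ∀ (g : G) (w : M), w ∈ f.range → single g (1 : F) • w ∈ f.range := by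
    rintro g _ ⟨a, rfl⟩
    refine ⟨fun x => a (g⁻¹ * x), ?_⟩
    change ∑ x, single x (c (a (g⁻¹ * x))) • v = single g (1 : F) • ∑ x, single x (c (a x)) • v
    rw [Finset.smul_sum, ← Equiv.sum_comp (Equiv.mulLeft g)]
    refine Finset.sum_congr rfl fun x _ => ?_
    rw [← mul_smul, single_mul_single]
    simp
  let _ : MulAction G f.range :=
    { smul := fun g w => ⟨single g (1 : F) • (w : M), hmem g w w.2⟩
      one_smul := fun w => Subtype.ext (one_smul (MonoidAlgebra F G) (w : M))
      mul_smul := fun g h w => Subtype.ext <| by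
        change single (g * h) (1 : F) • (w : M) = single g (1 : F) • single h (1 : F) • (w : M)
        rw [← mul_smul, single_mul_single, one_mul] }
  -- `G` itself need not be a `p`-group, but its image in the permutations is one, because `N` acts
  -- trivially.
  let φ : G →* Equiv.Perm f.range := MulAction.toPermHom G f.range
  have hφ : IsPGroup p φ.range := by
    rintro ⟨_, g, rfl⟩
    obtain ⟨k, hk⟩ := hN (g : G ⧸ N)
    refine ⟨k, Subtype.ext ?_⟩
    have hg : g ^ p ^ k ∈ N := by
      rw [← QuotientGroup.eq_one_iff]
      simpa using hk
    change φ g ^ p ^ k = 1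
    rw [← map_pow]
    ext w
    exact hM _ hg w
  have : Finite f.range := Set.finite_range f
  have hvf : v ∈ f.range := by
    refine ⟨Pi.single (M := fun _ => ZMod p) 1 1, ?_⟩
    change ∑ g, single g (c (Pi.single (M := fun _ => ZMod p) (1 : G) 1 g)) • v = v
    rw [Finset.sum_eq_single 1]
    · rw [Pi.single_eq_same, map_one]
      exact one_smul (MonoidAlgebra F G) v
    · intro g _ hg
      simp [hg]
    · simp
  have hpv : p • v = 0 := by
    rw [← one_smul (MonoidAlgebra F G) v, ← smul_assoc, nsmul_eq_mul, mul_one, natCast_def]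
    simp
  have hdvd : p ∣ Nat.card f.range := by
    have h := AddSubgroup.addOrderOf_dvd_natCard _ hvf
    rwa [addOrderOf_eq_prime hpv hv] at h
  have hzero : (0 : f.range) ∈ MulAction.fixedPoints φ.range f.range := by
    rintro ⟨_, g, rfl⟩
    exact Subtype.ext (smul_zero _)
  obtain ⟨w, hw, hw0⟩ :=
    hφ.exists_fixed_point_of_prime_dvd_card_of_fixed_point f.range hdvd hzero
  refine ⟨w, fun h => hw0 (Subtype.ext h.symm), fun g => ?_⟩
  exact congrArg Subtype.val (hw ⟨φ g, g, rfl⟩)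

end FixedVector

/-! ### Modules over a `p`-group quotient. -/

section TrivialAction

open MonoidAlgebra

variable {F G : Type*} [Field F] [Group G]

theorem ActsTrivially.mono {N N' : Subgroup G} (h : N ≤ N') {M : Type*} [AddCommGroup M]
    [Module (MonoidAlgebra F G) M] (hM : ActsTrivially F N' M) : ActsTrivially F N M :=
  fun g hg => hM g (h hg)

theorem ActsTrivially.submodule {N : Subgroup G} {M : Type*} [AddCommGroup M]
    [Module (MonoidAlgebra F G) M] (hM : ActsTrivially F N M)
    (U : Submodule (MonoidAlgebra F G) M) : ActsTrivially F N U :=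
  fun g hg u => Subtype.ext (hM g hg u)

theorem ActsTrivially.quotient {N : Subgroup G} {M : Type*} [AddCommGroup M]
    [Module (MonoidAlgebra F G) M] (hM : ActsTrivially F N M)
    (U : Submodule (MonoidAlgebra F G) M) : ActsTrivially F N (M ⧸ U) := by
  rintro g hg u
  obtain ⟨u, rfl⟩ := U.mkQ_surjective u
  rw [← map_smul, hM g hg]

section Tower

variable {M : Type*} [AddCommGroup M] [Module F M] [Module (MonoidAlgebra F G) M]
  [IsScalarTower F (MonoidAlgebra F G) M]

theorem smul_mem_span_singleton_of_fixed {v : M} (hv : ∀ g : G, single g (1 : F) • v = v)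
    (a : MonoidAlgebra F G) {w : M} (hw : w ∈ Submodule.span F {v}) :
    a • w ∈ Submodule.span F {v} := by
  obtain ⟨c, rfl⟩ := Submodule.mem_span_singleton.mp hw
  induction a using MonoidAlgebra.induction_on with
  | of g =>
    rw [smul_algebra_smul_comm, of_apply, hv]
    exact Submodule.smul_mem _ _ (Submodule.mem_span_singleton_self v)
  | add x y hx hy => rw [add_smul]; exact Submodule.add_mem _ hx hy
  | smul r x hx => rw [smul_assoc]; exact Submodule.smul_mem _ _ hx

/-- The line spanned by a fixed vector, as a submodule over the group algebra. -/
def fixedLine {v : M} (hv : ∀ g : G, single g (1 : F) • v = v) :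
    Submodule (MonoidAlgebra F G) M :=
  { Submodule.span F {v} with
    smul_mem' := fun a _ hw => smul_mem_span_singleton_of_fixed hv a hw }

theorem finrank_fixedLine {v : M} (hv : ∀ g : G, single g (1 : F) • v = v) (h0 : v ≠ 0) :
    Module.finrank F (fixedLine hv) = 1 :=
  finrank_span_singleton (K := F) h0

theorem mem_fixedLine {v : M} (hv : ∀ g : G, single g (1 : F) • v = v) : v ∈ fixedLine hv :=
  Submodule.mem_span_singleton_self v

theorem actsTrivially_fixedLine {v : M} (hv : ∀ g : G, single g (1 : F) • v = v) :
    ActsTrivially F (⊤ : Subgroup G) (fixedLine hv) := by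
  rintro g - ⟨w, hw⟩
  obtain ⟨c, rfl⟩ := Submodule.mem_span_singleton.mp hw
  refine Subtype.ext ?_
  change single g (1 : F) • c • v = c • v
  rw [smul_algebra_smul_comm, hv]

theorem nonempty_equiv_of_actsTrivially_of_finrank_eq_one {M' : Type*} [AddCommGroup M']
    [Module F M'] [Module (MonoidAlgebra F G) M'] [IsScalarTower F (MonoidAlgebra F G) M']
    (hM : ActsTrivially F (⊤ : Subgroup G) M) (hM' : ActsTrivially F (⊤ : Subgroup G) M')
    (h : Module.finrank F M = 1) (h' : Module.finrank F M' = 1) :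
    Nonempty (M ≃ₗ[MonoidAlgebra F G] M') := by
  have : FiniteDimensional F M := FiniteDimensional.of_finrank_eq_succ h
  have : FiniteDimensional F M' := FiniteDimensional.of_finrank_eq_succ h'
  let e : M ≃ₗ[F] M' := LinearEquiv.ofFinrankEq M M' (h.trans h'.symm)
  refine ⟨{ e with map_smul' := fun a x => ?_ }⟩
  change e (a • x) = a • e x
  induction a using MonoidAlgebra.induction_on with
  | of g => rw [of_apply, hM g trivial, hM' g trivial]
  | add a b ha hb => rw [add_smul, map_add, ha, hb, add_smul]
  | smul r a ha => rw [smul_assoc, map_smul, ha, smul_assoc]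

/-- The line spanned by a nonzero fixed vector is a submodule, hence all of `M` by simplicity. -/
theorem actsTrivially_top_and_finrank_eq_one [Finite G] [IsSimpleModule (MonoidAlgebra F G) M]
    (p : ℕ) [Fact p.Prime] [CharP F p] {N : Subgroup G} [N.Normal] (hN : IsPGroup p (G ⧸ N))
    (hM : ActsTrivially F N M) :
    ActsTrivially F (⊤ : Subgroup G) M ∧ Module.finrank F M = 1 := by
  have := IsSimpleModule.nontrivial (MonoidAlgebra F G) M
  obtain ⟨v, hv0, hv⟩ := exists_fixed_ne_zero p hN hM
  have htop : fixedLine hv = ⊤ := (eq_bot_or_eq_top _).resolve_left fun h =>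
    hv0 ((Submodule.mem_bot (MonoidAlgebra F G)).mp (h ▸ mem_fixedLine hv))
  have hmem : ∀ x : M, x ∈ fixedLine hv := fun x => htop ▸ Submodule.mem_top
  refine ⟨fun g hg x =>
    congrArg Subtype.val (actsTrivially_fixedLine hv g hg ⟨x, hmem x⟩), ?_⟩
  rw [← finrank_fixedLine hv hv0]
  exact ((LinearEquiv.ofTop _ htop).restrictScalars F).finrank_eq.symm

end Tower

variable [Finite G] {P : Type*} [AddCommGroup P] [Module F P] [Module (MonoidAlgebra F G) P]
  [IsScalarTower F (MonoidAlgebra F G) P] [FiniteDimensional F P]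
  [Module.Projective (MonoidAlgebra F G) P]
  {E : Type*} [AddCommGroup E] [Module F E] [Module (MonoidAlgebra F G) E]
  [IsScalarTower F (MonoidAlgebra F G) E]

variable (P) in
-- Every composition factor of `M` is the trivial line: split off a fixed line and induct on the
-- dimension.
theorem homDim_eq_finrank_mul (p : ℕ) [Fact p.Prime] [CharP F p]
    (hE : ActsTrivially F (⊤ : Subgroup G) E) (hE1 : Module.finrank F E = 1)
    {N : Subgroup G} [N.Normal] (hN : IsPGroup p (G ⧸ N))
    {M : Type*} [AddCommGroup M] [Module F M] [Module (MonoidAlgebra F G) M]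
    [IsScalarTower F (MonoidAlgebra F G) M] [FiniteDimensional F M] (hM : ActsTrivially F N M) :
    homDim F (MonoidAlgebra F G) P M =
      Module.finrank F M * homDim F (MonoidAlgebra F G) P E := by
  induction hd : Module.finrank F M using Nat.strong_induction_on generalizing M with
  | _ d ih =>
    rcases subsingleton_or_nontrivial M with hs | hs
    · rw [← hd, Module.finrank_zero_of_subsingleton, zero_mul]
      exact Module.finrank_zero_of_subsingleton
    · obtain ⟨v, hv0, hv⟩ := exists_fixed_ne_zero p hN hM
      have hfin : Module.finrank F (M ⧸ fixedLine hv) + 1 = d := by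
        rw [← hd, ← finrank_fixedLine hv hv0]
        exact Submodule.finrank_quotient_add_finrank ((fixedLine hv).restrictScalars F)
      have : FiniteDimensional F (M ⧸ fixedLine hv) :=
        Module.Finite.of_surjective ((fixedLine hv).mkQ.restrictScalars F)
          (fixedLine hv).mkQ_surjective
      rw [homDim_eq_add_quotient P (fixedLine hv),
        ih _ (by omega) (hM.quotient (fixedLine hv)) rfl,
        homDim_congr P (nonempty_equiv_of_actsTrivially_of_finrank_eq_one
          (actsTrivially_fixedLine hv) hE (finrank_fixedLine hv hv0) hE1).some, ← hfin]
      ring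

end TrivialAction

/-! ### The descending chain of submodules `s_N P`. -/

section NormalSeries

open MonoidAlgebra

variable {F G : Type*} [Field F] [Group G] [Fintype G]
  {P : Type*} [AddCommGroup P] [Module F P] [Module (MonoidAlgebra F G) P]
  [IsScalarTower F (MonoidAlgebra F G) P] [FiniteDimensional F P]
  {E : Type*} [AddCommGroup E] [Module F E] [Module (MonoidAlgebra F G) E]
  [IsScalarTower F (MonoidAlgebra F G) E] [IsSimpleModule (MonoidAlgebra F G) E]
  {π : P →ₗ[MonoidAlgebra F G] E}

instance finiteDimensional_submodule_of_tower (U : Submodule (MonoidAlgebra F G) P) :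
    FiniteDimensional F U :=
  FiniteDimensional.of_injective (U.subtype.restrictScalars F) U.injective_subtype

omit [Module F P] [IsScalarTower F (MonoidAlgebra F G) P] [FiniteDimensional F P] in
theorem range_subgroupSumHom_le {N N' : Subgroup G} [N.Normal] [N'.Normal] (h : N ≤ N') :
    LinearMap.range (subgroupSumHom F N' P) ≤ LinearMap.range (subgroupSumHom F N P) := by
  obtain ⟨t, ht, -⟩ := exists_mul_subgroupSum (F := F) h P
  rintro _ ⟨x, rfl⟩
  exact ⟨t • x, by
    rw [subgroupSumHom_apply, subgroupSumHom_apply, ht, commute_subgroupSum, mul_smul]⟩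

/-- If `s_N P` were contained in `s_{N'} P`, it would be fixed by `N'`. Then `s_{N'} P = t s_N P`
would vanish, as `t` acts there by a multiple of `p`; but `s_{N'} P` is nonzero. -/
theorem IsProjectiveCover.homDim_range_add_le (hπ : IsProjectiveCover π) (p : ℕ) [Fact p.Prime]
    [CharP F p] {N N' : Subgroup G} [N.Normal] [N'.Normal] (h : N ≤ N')
    (hdvd : p ∣ Nat.card (N' ⧸ N.subgroupOf N')) (hE : ActsTrivially F N' E) :
    homDim F (MonoidAlgebra F G) P (LinearMap.range (subgroupSumHom F N' P)) +
        homDim F (MonoidAlgebra F G) P E ≤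
      homDim F (MonoidAlgebra F G) P (LinearMap.range (subgroupSumHom F N P)) := by
  have := hπ.projective
  have := IsSimpleModule.nontrivial (MonoidAlgebra F G) E
  have hle := range_subgroupSumHom_le (F := F) (P := P) h
  rw [homDim_eq_add_submoduleOf P hle]
  refine Nat.add_le_add_left ?_ _
  set R := LinearMap.range (subgroupSumHom F N P)
  set R' := LinearMap.range (subgroupSumHom F N' P)
  have hnot : ¬ R ≤ R' := by
    intro hRR
    obtain ⟨x, hx⟩ := exists_subgroupSum_smul_ne_zero (F := F) hE π hπ.surjective
    apply hx
    obtain ⟨t, ht, ht'⟩ := exists_mul_subgroupSum (F := F) h P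
    have hmem : subgroupSum F N • x ∈ R' := hRR ⟨x, rfl⟩
    have hfix : ∀ g ∈ N', single g (1 : F) • (subgroupSum F N • x) = subgroupSum F N • x :=
      fun g hg => congrArg Subtype.val (actsTrivially_range_subgroupSumHom N' g hg ⟨_, hmem⟩)
    rw [ht, mul_smul, ht' _ hfix, ← Nat.cast_smul_eq_nsmul F,
      (CharP.cast_eq_zero_iff F p _).mpr hdvd, zero_smul]
  have : Nontrivial (R ⧸ R'.submoduleOf R) := by
    rw [Submodule.Quotient.nontrivial_iff, Ne, Submodule.submoduleOf_eq_top]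
    exact hnot
  have : FiniteDimensional F (R ⧸ R'.submoduleOf R) :=
    Module.Finite.of_surjective ((R'.submoduleOf R).mkQ.restrictScalars F)
      (R'.submoduleOf R).mkQ_surjective
  obtain ⟨g, hg⟩ := hπ.exists_surjective_of_surjective
    ((R'.submoduleOf R).mkQ ∘ₗ (subgroupSumHom F N P).rangeRestrict)
    ((R'.submoduleOf R).mkQ_surjective.comp (LinearMap.surjective_rangeRestrict _))
  exact homDim_le_of_surjective P g hg

theorem IsProjectiveCover.homDim_le_homDim_range (hπ : IsProjectiveCover π)
    {N : Subgroup G} [N.Normal] (hE : ActsTrivially F N E) :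
    homDim F (MonoidAlgebra F G) P E ≤
      homDim F (MonoidAlgebra F G) P (LinearMap.range (subgroupSumHom F N P)) := by
  have := hπ.projective
  have := IsSimpleModule.nontrivial (MonoidAlgebra F G) E
  have : Nontrivial (LinearMap.range (subgroupSumHom F N P)) := by
    obtain ⟨x, hx⟩ := exists_subgroupSum_smul_ne_zero (F := F) hE π hπ.surjective
    exact ⟨⟨_, x, rfl⟩, 0, fun h => hx (congrArg Subtype.val h)⟩
  obtain ⟨g, hg⟩ := hπ.exists_surjective_of_surjective
    (subgroupSumHom F N P).rangeRestrict (LinearMap.surjective_rangeRestrict _)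
  exact homDim_le_of_surjective P g hg

/-- All composition factors of `s_N P` are isomorphic to `E`, so it suffices to bound its dimension,
by embedding `s_N F[G]` through `a ↦ a • x`. -/
theorem IsProjectiveCover.card_mul_le_homDim_range (hπ : IsProjectiveCover π) (p : ℕ)
    [Fact p.Prime] [CharP F p] {N : Subgroup G} [N.Normal] (hN : IsPGroup p (G ⧸ N))
    (hE : ActsTrivially F N E) :
    Nat.card (G ⧸ N) * homDim F (MonoidAlgebra F G) P E ≤
      homDim F (MonoidAlgebra F G) P (LinearMap.range (subgroupSumHom F N P)) := by
  have := hπ.projective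
  have := IsSimpleModule.nontrivial (MonoidAlgebra F G) E
  obtain ⟨hE', hE1⟩ := actsTrivially_top_and_finrank_eq_one p hN hE
  rw [homDim_eq_finrank_mul P p hE' hE1 hN (actsTrivially_range_subgroupSumHom (F := F) N)]
  refine Nat.mul_le_mul_right _ ((card_quotient_le_finrank_range_subgroupSumHom (F := F) N).trans ?_)
  -- Here `x` is not killed by `s_G`. A nonzero kernel of `a ↦ a • x` would contain a nonzero
  -- `G`-fixed element of `F[G]`; its coefficients are constant, so it is a multiple of `s_G`.
  obtain ⟨x, hx⟩ := exists_subgroupSum_smul_ne_zero (F := F) hE' π hπ.surjective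
  let R := LinearMap.range (subgroupSumHom F N (MonoidAlgebra F G))
  let f : R →ₗ[MonoidAlgebra F G] P := LinearMap.toSpanSingleton _ P x ∘ₗ R.subtype
  have hf : Function.Injective f := by
    rw [← LinearMap.ker_eq_bot]
    by_contra hne
    have : Nontrivial (LinearMap.ker f) := Submodule.nontrivial_iff_ne_bot.mpr hne
    obtain ⟨⟨⟨b, hb⟩, hbk⟩, hb0, hbfix⟩ := exists_fixed_ne_zero p hN
      ((actsTrivially_range_subgroupSumHom (F := F) (M := MonoidAlgebra F G) N).submodule
        (LinearMap.ker f))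
    have hbx : b • x = 0 := hbk
    have hbfix' : ∀ g : G, single g (1 : F) * b = b := fun g =>
      congrArg (fun z => ((z : R) : MonoidAlgebra F G)) (congrArg Subtype.val (hbfix g))
    have hcoeff : ∀ g : G, b.coeff g = b.coeff 1 := fun g => by
      conv_lhs => rw [← hbfix' g]
      simp [coeff_single_mul_apply]
    have hbeq : b = b.coeff 1 • subgroupSum F (⊤ : Subgroup G) := by
      classical
      ext g
      simp [subgroupSum, hcoeff g, Finsupp.single_apply]
    have hc : b.coeff 1 ≠ 0 := by
      intro h
      apply hb0
      rw [h, zero_smul] at hbeq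
      exact Subtype.ext (Subtype.ext hbeq)
    rw [hbeq, smul_assoc] at hbx
    exact hx ((smul_eq_zero.mp hbx).resolve_left hc)
  let f' : R →ₗ[MonoidAlgebra F G] LinearMap.range (subgroupSumHom F N P) :=
    f.codRestrict _ (by
      rintro ⟨_, a, rfl⟩
      exact ⟨a • x, (mul_smul _ a x).symm⟩)
  exact LinearMap.finrank_le_finrank_of_injective (f := f'.restrictScalars F) fun a b h =>
    hf (congrArg Subtype.val h)

open Classical in
theorem IsProjectiveCover.homDim_range_add_card_mul_le (hπ : IsProjectiveCover π) (p : ℕ)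
    [Fact p.Prime] [CharP F p] {n : ℕ} (H : Fin (n + 1) → Subgroup G) [∀ i, (H i).Normal]
    (hmono : Monotone H) (hE : ActsTrivially F (H (Fin.last n)) E) :
    homDim F (MonoidAlgebra F G) P (LinearMap.range (subgroupSumHom F (H (Fin.last n)) P)) +
        Finset.card {i : Fin n | p ∣ Nat.card (H i.succ ⧸ (H i.castSucc).subgroupOf (H i.succ))} *
          homDim F (MonoidAlgebra F G) P E ≤
      homDim F (MonoidAlgebra F G) P P := by
  have := hπ.projective
  have h := Fin.add_sum_le_apply_zero
    (fun i => homDim F (MonoidAlgebra F G) P (LinearMap.range (subgroupSumHom F (H i) P)))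
    (fun i => if p ∣ Nat.card (H i.succ ⧸ (H i.castSucc).subgroupOf (H i.succ))
      then homDim F (MonoidAlgebra F G) P E else 0) fun i => by
        have hi := hmono (Fin.castSucc_le_succ i)
        split_ifs with hd
        · exact hπ.homDim_range_add_le p hi hd (hE.mono (hmono (Fin.le_last _)))
        · exact homDim_le_of_injective P
            (Submodule.inclusion (range_subgroupSumHom_le (F := F) (P := P) hi))
            (Submodule.inclusion_injective _)
  rw [← Finset.sum_filter, Finset.sum_const, smul_eq_mul] at h
  exact h.trans (homDim_le_of_injective P (Submodule.subtype _) (Submodule.injective_subtype _))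

end NormalSeries

/-! ### Lower bounds for the Cartan invariant. -/

section CartanNumber

variable {F G : Type*} [Field F] [Group G] [Finite G]
  {E : Type*} [AddCommGroup E] [Module F E] [Module (MonoidAlgebra F G) E]
  [IsScalarTower F (MonoidAlgebra F G) E] [IsSimpleModule (MonoidAlgebra F G) E]

theorem exists_isProjectiveCover_homDim_eq_cartanNumber_mul :
    ∃ (P : Submodule (MonoidAlgebra F G) (MonoidAlgebra F G)) (π : P →ₗ[MonoidAlgebra F G] E),
      IsProjectiveCover π ∧ homDim F (MonoidAlgebra F G) P P =
        cartanNumber (MonoidAlgebra F G) E * homDim F (MonoidAlgebra F G) P E := by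
  have : IsArtinianRing (MonoidAlgebra F G) := isArtinian_of_tower F inferInstance
  have := Fintype.ofFinite G
  have h := exists_isProjectiveCover (A := MonoidAlgebra F G) E
  obtain ⟨π, hπ⟩ := h.choose_spec
  refine ⟨h.choose, π, hπ, ?_⟩
  rw [cartanNumber, dif_pos h]
  exact hπ.homDim_eq_compositionMultiplicity_mul

theorem dvd_card_of_isPGroup_of_nontrivial {p : ℕ} [Fact p.Prime] {Q : Type*} [Group Q] [Finite Q]
    (hp : IsPGroup p Q) [Nontrivial Q] : p ∣ Nat.card Q :=
  hp.card_eq_or_dvd.resolve_left (Finite.one_lt_card (α := Q)).ne'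

variable (p : ℕ) [Fact p.Prime] [CharP F p] {n : ℕ} (H : Fin (n + 2) → Subgroup G)
  [∀ i, (H i).Normal]

-- The last factor is split off because the chain stops at `G_n`, the subgroup assumed to act
-- trivially on `E`. For the others only divisibility of the order by `p` matters.
open Classical in
theorem pFactorCount_le :
    pFactorCount p H ≤
      Finset.card {i : Fin n | p ∣ Nat.card
        (H i.succ.castSucc ⧸ (H i.castSucc.castSucc).subgroupOf (H i.succ.castSucc))} +
      if IsPGroup p (H (Fin.last n).succ ⧸
            (H (Fin.last n).castSucc).subgroupOf (H (Fin.last n).succ)) ∧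
          Nontrivial (H (Fin.last n).succ ⧸
            (H (Fin.last n).castSucc).subgroupOf (H (Fin.last n).succ)) then 1 else 0 := by
  rw [pFactorCount, Finset.card_filter, Finset.card_filter, Fin.sum_univ_castSucc]
  refine Nat.add_le_add_right (Finset.sum_le_sum fun i _ => ?_) _
  split_ifs with h1 h2 h2
  · exact le_rfl
  · obtain ⟨h1, h3⟩ := h1
    exact absurd (dvd_card_of_isPGroup_of_nontrivial h1) h2
  · exact zero_le_one
  · exact le_rfl

theorem pFactorCount_bounds (hmono : Monotone H) (htop : H (Fin.last (n + 1)) = ⊤)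
    (hE : ActsTrivially F (H (Fin.last n).castSucc) E) :
    pFactorCount p H + 1 ≤ cartanNumber (MonoidAlgebra F G) E ∧
      (IsPGroup p (G ⧸ H (Fin.last n).castSucc) →
        Nat.card (G ⧸ H (Fin.last n).castSucc) + pFactorCount p H - 1 ≤
          cartanNumber (MonoidAlgebra F G) E) := by
  classical
  have := Fintype.ofFinite G
  obtain ⟨P, π, hπ, hP⟩ := exists_isProjectiveCover_homDim_eq_cartanNumber_mul (F := F) (G := G)
    (E := E)
  have hd := hπ.homDim_pos (F := F)
  have hchain := hπ.homDim_range_add_card_mul_le p (fun i : Fin (n + 1) => H i.castSucc)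
    (hmono.comp Fin.strictMono_castSucc.monotone) hE
  rw [hP] at hchain
  have hcount := pFactorCount_le p H
  set k := Finset.card {i : Fin n | p ∣ Nat.card
    (H i.succ.castSucc ⧸ (H i.castSucc.castSucc).subgroupOf (H i.succ.castSucc))}
  set N := H (Fin.last n).castSucc
  set c := cartanNumber (MonoidAlgebra F G) E
  -- `m` is the contribution of the bottom term `s_{G_n} P`, and `k` counts only factors below
  -- `G_n`.
  have hlow : ∀ m, m * homDim F (MonoidAlgebra F G) P E ≤
      homDim F (MonoidAlgebra F G) P (LinearMap.range (subgroupSumHom F N P)) → m + k ≤ c := by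
    intro m hm
    refine Nat.le_of_mul_le_mul_right ?_ hd
    rw [add_mul]
    exact (Nat.add_le_add_right hm _).trans hchain
  have hpart : IsPGroup p (G ⧸ N) → Nat.card (G ⧸ N) + k ≤ c := fun hN =>
    hlow _ (hπ.card_mul_le_homDim_range p hN hE)
  have hone : 1 + k ≤ c := hlow 1 (by simpa using hπ.homDim_le_homDim_range hE)
  have htop' : H (Fin.last n).succ = ⊤ := htop
  refine ⟨?_, fun hN => ?_⟩
  -- If the last factor is a nontrivial `p`-group, `|G/G_n| ≥ 2` pays for both it and the extra `1`.
  · split_ifs at hcount with hlast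
    · obtain ⟨hp, hnt⟩ := hlast
      have h1 : IsPGroup p (G ⧸ N) := by
        intro q
        obtain ⟨g, rfl⟩ := QuotientGroup.mk_surjective q
        obtain ⟨m, hm⟩ := hp (QuotientGroup.mk ⟨g, htop' ▸ Subgroup.mem_top g⟩)
        refine ⟨m, ?_⟩
        rw [← QuotientGroup.mk_pow, QuotientGroup.eq_one_iff] at hm ⊢
        exact Subgroup.mem_subgroupOf.mp hm
      have h2 : 1 < Nat.card (G ⧸ N) := by
        have h3 : 1 < N.relIndex (H (Fin.last n).succ) := Finite.one_lt_card
        rwa [htop', Subgroup.relIndex_top_right] at h3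
      have := hpart h1
      omega
    · omega
  · change Nat.card (G ⧸ N) + pFactorCount p H - 1 ≤ c
    have := hpart hN
    split_ifs at hcount <;> omega

end CartanNumber

/-! ### Inflated and trivial representations as modules. -/

section Representation

variable {F G V : Type*} [Field F] [Group G] [AddCommGroup V] [Module F V]

/-- Inflation does not change the lattice of subrepresentations. -/
def subrepresentationInflateOrderIso (N : Subgroup G) [N.Normal]
    (ρ : Representation F (G ⧸ N) V) :
    Subrepresentation (inflate N ρ) ≃o Subrepresentation ρ where
  toFun W := ⟨W.toSubmodule, fun q v hv => by
    obtain ⟨g, rfl⟩ := QuotientGroup.mk_surjective q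
    exact W.apply_mem_toSubmodule g hv⟩
  invFun W := ⟨W.toSubmodule, fun g _ hv => W.apply_mem_toSubmodule (g : G ⧸ N) hv⟩
  left_inv _ := rfl
  right_inv _ := rfl
  map_rel_iff' := Iff.rfl

theorem isIrreducible_inflate {N : Subgroup G} [N.Normal] {ρ : Representation F (G ⧸ N) V}
    (hρ : ρ.IsIrreducible) : (inflate N ρ).IsIrreducible :=
  (OrderIso.isSimpleOrder_iff (subrepresentationInflateOrderIso N ρ)).mpr hρ

theorem actsTrivially_inflate (N : Subgroup G) [N.Normal] (ρ : Representation F (G ⧸ N) V) :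
    ActsTrivially F N (inflate N ρ).asModule := by
  intro h hh v
  rw [Representation.single_smul, one_smul]
  have h1 : inflate N ρ h = 1 := by
    change ρ (h : G ⧸ N) = 1
    rw [(QuotientGroup.eq_one_iff h).mpr hh, map_one]
  rw [h1]
  rfl

theorem actsTrivially_trivial (N : Subgroup G) :
    ActsTrivially F N (Representation.trivial F G V).asModule := by
  intro h _ v
  rw [Representation.single_smul, one_smul]
  rfl

theorem isIrreducible_trivial : (Representation.trivial F G F).IsIrreducible := by
  rw [Representation.irreducible_iff_isSimpleModule_asModule, isSimpleModule_iff]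
  have : Nontrivial (Representation.trivial F G F).asModule := inferInstanceAs (Nontrivial F)
  refine { eq_bot_or_eq_top := fun U => ?_ }
  have : IsSimpleModule F (Representation.trivial F G F).asModule :=
    inferInstanceAs (IsSimpleModule F F)
  have h := eq_bot_or_eq_top (U.restrictScalars F)
  simpa using h

end Representation

theorem theorem5p7 {F G : Type*} [Field F] [Group G] [Finite G] (p : ℕ) [Fact p.Prime] [CharP F p]
    (n : ℕ) (H : Fin (n + 2) → Subgroup G) [∀ i, (H i).Normal]
    (hbot : H 0 = ⊥) (htop : H (Fin.last (n + 1)) = ⊤) (hmono : Monotone H) :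
    -- `H (Fin.last n).castSucc` is the term of index `n`, the last one before `G`
    (∀ {V : Type*} [AddCommGroup V] [Module F V]
        (ρ : Representation F (G ⧸ H (Fin.last n).castSucc) V), ρ.IsIrreducible →
        pFactorCount p H + 1 ≤ groupCartanNumber (inflate (H (Fin.last n).castSucc) ρ)) ∧
      (IsPGroup p (G ⧸ H (Fin.last n).castSucc) →
        Nat.card (G ⧸ H (Fin.last n).castSucc) + pFactorCount p H - 1 ≤
          groupCartanNumber (Representation.trivial F G F)) := by
  refine ⟨fun ρ hρ => ?_, fun hN => ?_⟩
  · have := (Representation.irreducible_iff_isSimpleModule_asModule _).mp (isIrreducible_inflate hρ)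
    exact (pFactorCount_bounds (F := F) p H hmono htop (actsTrivially_inflate _ ρ)).1
  · have := (Representation.irreducible_iff_isSimpleModule_asModule _).mp
      (isIrreducible_trivial (F := F) (G := G))
    exact (pFactorCount_bounds (F := F) p H hmono htop (actsTrivially_trivial _)).2 hN
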